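/- Let $p,q\in(1,+\infty)$ with $\frac1p+\frac1q=1$, let $X$ be a real Banach space, and let $f:X\to\mathbb R\cup\{+\infty\}$ be proper (that is, $\operatorname{dom} f:=\{x\in X: f(x)<+\infty\}\neq\emptyset$) and lower semicontinuous. For $x\in X$ let $$\partial f(x):=\{\xi\in X^*:\ x \text{ is a global minimizer of } f-\xi\}$$ be the Fenchel–Moreau subdifferential of $f$ at $x$, and let $d(0,\partial f(x)):=\inf\{\|\xi\|:\xi\in\partial f(x)\}$, with $\inf\emptyset=+\infty$ (and $\mu\cdot(+\infty)^q=+\infty$ for $\mu>0$). Let $\bar x\in(\partial f)^{-1}(0)$, i.e. $\bar x$ is a global minimizer of $f$, and suppose that this minimizer is strict: $f(\bar x)<f(x)$ for every $x\in X\setminus\{\bar x\}$. Suppose that $\overline{\mathrm{conv}}(\operatorname{dom} f)$ is bounded and has the Radon–Nikodým property: for every nonempty bounded subset $A$ of it and every $\varepsilon>0$ there are $\delta>0$ and $\xi\in X^*$ such that the slice $\{v\in A:\langle\xi,v\rangle<\inf_{w\in A}\langle\xi,w\rangle+\delta\}$ has diameter less than $\varepsilon$. Then the following assertions are equivalent.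 (i) There exists $\gamma>0$ such that $f(x)\ge f(\bar x)+\gamma\|x-\bar x\|^p$ for every $x\in X$. (ii) There exists $\mu>0$ such that $f(x)-f(\bar x)\le\mu\, d(0,\partial f(x))^q$ for every $x\in X$. -/

import Mathlib

open scoped ENNReal

/-- The effective domain of an extended-real-valued function. -/
def effDom {X : Type*} (f : X → EReal) : Set X :=
  {x | f x < ⊤}

/-- A function with values in `ℝ ∪ {+∞}` that is not identically `+∞`. -/
def IsProperFun {X : Type*} (f : X → EReal) : Prop :=
  (∀ x, f x ≠ ⊥) ∧ (effDom f).Nonempty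

/-- The Fenchel–Moreau subdifferential of `f` at `x`: the continuous linear functionals `ξ` such
that `x` is a global minimizer of `f - ξ`. -/
def fmSubdiff {X : Type*} [NormedAddCommGroup X] [NormedSpace ℝ X] (f : X → EReal) (x : X) :
    Set (StrongDual ℝ X) :=
  {ξ | ∀ y, f x - ((ξ x : ℝ) : EReal) ≤ f y - ((ξ y : ℝ) : EReal)}

/-- The slice `{v ∈ W : ⟨ξ, v⟩ < inf_{w ∈ W} ⟨ξ, w⟩ + δ}`. It is only used for nonempty bounded
`W`, for which the infimum is a genuine real infimum. -/
def dualSlice {X : Type*} [NormedAddCommGroup X] [NormedSpace ℝ X] (W : Set X)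
    (ξ : StrongDual ℝ X) (δ : ℝ) : Set X :=
  {v | v ∈ W ∧ ξ v < sInf (ξ '' W) + δ}

/-- Dentability of a (nonempty bounded) set: it has slices of arbitrarily small diameter. -/
def IsDentable {X : Type*} [NormedAddCommGroup X] [NormedSpace ℝ X] (W : Set X) : Prop :=
  ∀ ε : ℝ, 0 < ε → ∃ δ : ℝ, 0 < δ ∧ ∃ ξ : StrongDual ℝ X, Metric.diam (dualSlice W ξ δ) < ε

/-- The Radon–Nikodým property of a set: each of its nonempty bounded subsets is dentable. -/
def HasRNP {X : Type*} [NormedAddCommGroup X] [NormedSpace ℝ X] (W : Set X) : Prop :=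
  ∀ A : Set X, A ⊆ W → A.Nonempty → Bornology.IsBounded A → IsDentable A

/-! Growth implies the error bound by pairing `γ * r ^ p ≤ a` with the subgradient inequality `a ≤ N
* r`.

For the converse, put F = f - f(b) on C = dom f, with b the minimizer, and let φ(ξ) = sup over C of
ξ(x - b) - F x. Stegall's principle (`dense_strongMax`), which rests on dentability and Baire
category, gives a dense set of ξ at which φ is attained, say at x. There ξ is a subgradient at x, so
F x ≤ μ‖ξ‖^q, hence φ(ξ) ≤ 2φ(ξ/2) + μ‖ξ‖^q; by continuity this holds for all ξ. Iterating compares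
φ with its slope at 0, which is governed by sublevel sets of arbitrarily small height. By
Hahn–Banach, each x with F x ≤ δ is then within a multiple of δ^(1/p) of the closed convex hull of
every lower sublevel set. Summing over halved levels gives the same kind of bound for the distance
to S, the intersection of these hulls.

As f need not be convex, S = {b} requires proof. If S had another point, Stegall's principle on S
would give a strongly exposed point s ≠ b. Points of low sublevel sets nearly maximizing the
exposing functional are close to S, hence to s, so lower semicontinuity forces F s ≤ 0, against
strictness. Thus ‖x - b‖ ≤ K F(x)^(1/p). -/

open Filter Topology

/-! ### Separation and nested closed convex hulls -/

/-- A point of the closed convex hull of `A` is not strictly separated from `A` by a functional. -/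
theorem exists_lt_of_mem_closedConvexHull {X : Type*} [NormedAddCommGroup X] [NormedSpace ℝ X]
    {A : Set X} {y : X} (hy : y ∈ closedConvexHull ℝ A) (ξ : StrongDual ℝ X) {c : ℝ}
    (hc : ξ y < c) : ∃ x ∈ A, ξ x < c := by
  by_contra! h
  have hcl : IsClosed {x | c ≤ ξ x} := isClosed_le continuous_const ξ.continuous
  have hcv : Convex ℝ {x | c ≤ ξ x} := convex_halfSpace_ge ξ.toLinearMap.isLinear c
  exact absurd (closedConvexHull_min h hcv hcl hy) (not_le.2 hc)

/-- If every functional takes on `B` values almost as large as at `x`, then `x` is close to the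
closed convex hull of `B`. -/
theorem infDist_closedConvexHull_le {X : Type*} [NormedAddCommGroup X] [NormedSpace ℝ X]
    {B : Set X} {x : X} {κ : ℝ} (hκ : 0 ≤ κ)
    (h : ∀ ξ : StrongDual ℝ X, ∃ z ∈ B, ξ x ≤ ξ z + κ * ‖ξ‖) :
    Metric.infDist x (closedConvexHull ℝ B) ≤ κ := by
  by_contra! hlt
  obtain ⟨r, hκr, hr⟩ := exists_between hlt
  have hr0 : 0 < r := hκ.trans_lt hκr
  have hdisj : Disjoint (Metric.ball x r) (closedConvexHull ℝ B) := by
    rw [Set.disjoint_left]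
    intro y hy hyB
    have := Metric.infDist_le_dist_of_mem (x := x) hyB
    rw [Metric.mem_ball, dist_comm] at hy
    linarith
  obtain ⟨g, u, hg1, hg2⟩ := geometric_hahn_banach_open (convex_ball x r) Metric.isOpen_ball
    convex_closedConvexHull hdisj
  -- Separation gives r‖g‖ ≤ g z - g x, while the hypothesis at `-g` gives g z - g x ≤ κ‖g‖; as κ <
  -- r, g = 0.
  obtain ⟨z, hz, hxz⟩ := h (-g)
  have hzu := hg2 z (subset_closedConvexHull hz)
  simp only [neg_apply, norm_neg] at hxz
  have hgx : g x < u := hg1 x (Metric.mem_ball_self hr0)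
  have key : ∀ v : X, ‖v‖ < 1 → r * g v < u - g x := by
    intro v hv
    have := hg1 (x + r • v) (by
      simp only [Metric.mem_ball, dist_self_add_left, norm_smul, Real.norm_eq_abs,
        abs_of_pos hr0]
      nlinarith)
    rw [map_add, map_smul, smul_eq_mul] at this
    linarith
  have hball : ‖g‖ ≤ (u - g x) / r := by
    refine le_of_forall_lt fun ρ hρ => ?_
    obtain ⟨v, hv, hρv⟩ := g.exists_lt_apply_of_lt_opNorm hρ
    rw [lt_div_iff₀ hr0]
    have h1 := key v hv
    have h2 := key (-v) (by rwa [norm_neg])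
    rw [map_neg] at h2
    rw [Real.norm_eq_abs] at hρv
    rcases abs_cases (g v) with ⟨h3, -⟩ | ⟨h3, -⟩ <;> nlinarith
  rw [le_div_iff₀ hr0] at hball
  have hg0 : ‖g‖ = 0 := by
    have := norm_nonneg g
    nlinarith
  rw [norm_eq_zero] at hg0
  subst hg0
  simp only [zero_apply] at hgx hzu
  linarith

/-- A decreasing sequence of sets whose support functions decrease by summable amounts stays close
to the intersection of the closed convex hulls. -/
theorem exists_mem_iInter_closedConvexHull {X : Type*} [NormedAddCommGroup X] [NormedSpace ℝ X]
    [CompleteSpace X] {A : ℕ → Set X} (hA : Antitone A) {κ : ℕ → ℝ} (hκ : ∀ n, 0 < κ n)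
    (hsum : Summable κ)
    (h : ∀ n, ∀ x ∈ A n, ∀ ξ : StrongDual ℝ X, ∃ z ∈ A (n + 1), ξ x ≤ ξ z + κ n * ‖ξ‖)
    {x : X} (hx : x ∈ A 0) :
    ∃ y ∈ ⋂ n, closedConvexHull ℝ (A n), dist x y ≤ ∑' n, 2 * κ n := by
  have hstep : ∀ n, ∀ y ∈ closedConvexHull ℝ (A n),
      ∃ y' ∈ closedConvexHull ℝ (A (n + 1)), dist y y' ≤ 2 * κ n := by
    intro n y hy
    have hne : (closedConvexHull ℝ (A (n + 1))).Nonempty := by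
      obtain ⟨w, hw, -⟩ := exists_lt_of_mem_closedConvexHull hy 0 (c := 1) (by simp)
      obtain ⟨z, hz, -⟩ := h n w hw 0
      exact ⟨z, subset_closedConvexHull hz⟩
    have hsub : closedConvexHull ℝ (A n) ⊆
        Metric.cthickening (κ n) (closedConvexHull ℝ (A (n + 1))) := by
      refine closedConvexHull_min (fun w hw => ?_) (convex_closedConvexHull.cthickening _)
        Metric.isClosed_cthickening
      rw [Metric.mem_cthickening_iff,
        ENNReal.le_ofReal_iff_toReal_le (Metric.infEDist_ne_top hne) (hκ n).le]
      exact infDist_closedConvexHull_le (hκ n).le (h n w hw)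
    have hy' := hsub hy
    rw [Metric.mem_cthickening_iff,
      ENNReal.le_ofReal_iff_toReal_le (Metric.infEDist_ne_top hne) (hκ n).le] at hy'
    -- The distance need not be attained; doubling `κ n > 0` leaves room to choose a point.
    have hlt : Metric.infDist y (closedConvexHull ℝ (A (n + 1))) < 2 * κ n :=
      lt_of_le_of_lt hy' (by linarith [hκ n])
    obtain ⟨y', hy'm, hd⟩ := (Metric.infDist_lt_iff hne).1 hlt
    exact ⟨y', hy'm, hd.le⟩
  choose! s hs hsd using hstep
  let u : ℕ → X := fun n => Nat.rec x (fun n y => s n y) n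
  have hu : ∀ n, u n ∈ closedConvexHull ℝ (A n) := by
    intro n
    induction n with
    | zero => exact subset_closedConvexHull hx
    | succ n ih => exact hs n _ ih
  have hud : ∀ n, dist (u n) (u n.succ) ≤ 2 * κ n := fun n => hsd n _ (hu n)
  have hsum' : Summable fun n => 2 * κ n := hsum.mul_left 2
  obtain ⟨y, hy⟩ := cauchySeq_tendsto_of_complete (cauchySeq_of_dist_le_of_summable _ hud hsum')
  refine ⟨y, Set.mem_iInter.2 fun n => ?_, dist_le_tsum_of_dist_le_of_tendsto₀ _ hud hsum' hy⟩
  refine isClosed_closedConvexHull.mem_of_tendsto hy ?_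
  filter_upwards [eventually_ge_atTop n] with m hm
  exact (closedConvexHull ℝ).monotone (hA hm) (hu m)

/-! ### Tilted suprema and near maximizers -/

/-- The supremum over `C` of the function `F` tilted by `ξ`, namely of `x ↦ ξ (x - b) - F x`. -/
noncomputable def tiltedSup {X : Type*} [NormedAddCommGroup X] [NormedSpace ℝ X] (C : Set X)
    (F : X → ℝ) (b : X) (ξ : StrongDual ℝ X) : ℝ :=
  sSup ((fun x => ξ (x - b) - F x) '' C)

/-- The points of `C` at which `x ↦ ξ (x - b) - F x` is maximal up to `α`. -/
def nearMax {X : Type*} [NormedAddCommGroup X] [NormedSpace ℝ X] (C : Set X)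
    (F : X → ℝ) (b : X) (ξ : StrongDual ℝ X) (α : ℝ) : Set X :=
  {x | x ∈ C ∧ tiltedSup C F b ξ - α ≤ ξ (x - b) - F x}

/-- A nonnegative function on a nonempty set contained in the ball of radius `M` around `b`. -/
structure IsTiltable {X : Type*} [NormedAddCommGroup X] (C : Set X)
    (F : X → ℝ) (b : X) (M : ℝ) : Prop where
  nonempty : C.Nonempty
  nonneg : ∀ x ∈ C, 0 ≤ F x
  norm_le : ∀ x ∈ C, ‖x - b‖ ≤ M

namespace IsTiltable

theorem radius_nonneg {X : Type*} [NormedAddCommGroup X] {C : Set X} {F : X → ℝ} {b : X} {M : ℝ}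
    (h : IsTiltable C F b M) : 0 ≤ M := by
  obtain ⟨x, hx⟩ := h.nonempty
  exact (norm_nonneg _).trans (h.norm_le x hx)

variable {X : Type*} [NormedAddCommGroup X] [NormedSpace ℝ X] {C : Set X} {F : X → ℝ} {b : X}
  {M : ℝ}

theorem apply_le (h : IsTiltable C F b M) (ξ : StrongDual ℝ X) {x : X} (hx : x ∈ C) :
    ξ (x - b) ≤ ‖ξ‖ * M :=
  (le_abs_self _).trans ((ξ.le_opNorm _).trans
    (mul_le_mul_of_nonneg_left (h.norm_le x hx) (norm_nonneg _)))

theorem le_tiltedSup (h : IsTiltable C F b M) (ξ : StrongDual ℝ X) {x : X} (hx : x ∈ C) :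
    ξ (x - b) - F x ≤ tiltedSup C F b ξ := by
  refine le_csSup ⟨‖ξ‖ * M, ?_⟩ ⟨x, hx, rfl⟩
  rintro _ ⟨y, hy, rfl⟩
  have := h.apply_le ξ hy
  have := h.nonneg y hy
  simp only
  linarith

theorem tiltedSup_le (h : IsTiltable C F b M) {ξ : StrongDual ℝ X} {a : ℝ}
    (ha : ∀ x ∈ C, ξ (x - b) - F x ≤ a) : tiltedSup C F b ξ ≤ a := by
  refine csSup_le (h.nonempty.image _) ?_
  rintro _ ⟨y, hy, rfl⟩
  exact ha y hy

theorem nearMax_nonempty (h : IsTiltable C F b M) (ξ : StrongDual ℝ X) {α : ℝ} (hα : 0 < α) :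
    (nearMax C F b ξ α).Nonempty := by
  obtain ⟨_, ⟨x, hx, rfl⟩, hlt⟩ := exists_lt_of_lt_csSup (h.nonempty.image _)
    (sub_lt_self (tiltedSup C F b ξ) hα)
  exact ⟨x, hx, hlt.le⟩

theorem tiltedSup_le_add (h : IsTiltable C F b M) (ξ ζ : StrongDual ℝ X) :
    tiltedSup C F b ξ ≤ tiltedSup C F b ζ + ‖ξ - ζ‖ * M := by
  refine h.tiltedSup_le fun x hx => ?_
  have h1 := h.le_tiltedSup ζ hx
  have h2 := h.apply_le (ξ - ζ) hx
  rw [sub_apply] at h2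
  linarith

theorem continuous_tiltedSup (h : IsTiltable C F b M) : Continuous (tiltedSup C F b) := by
  refine (LipschitzWith.of_le_add_mul M.toNNReal fun ξ ζ => ?_).continuous
  rw [Real.coe_toNNReal _ h.radius_nonneg, dist_eq_norm, mul_comm]
  exact h.tiltedSup_le_add ξ ζ

/-- The supremum and the tilted value each move by at most ‖ξ - ζ‖M, hence the factor 2. -/
theorem nearMax_subset (h : IsTiltable C F b M) {ξ ζ : StrongDual ℝ X} {α β : ℝ}
    (hαβ : β + 2 * (‖ξ - ζ‖ * M) ≤ α) : nearMax C F b ζ β ⊆ nearMax C F b ξ α := by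
  rintro x ⟨hx, hxβ⟩
  refine ⟨hx, ?_⟩
  have h1 := h.tiltedSup_le_add ξ ζ
  have h2 := h.apply_le (ζ - ξ) hx
  rw [sub_apply, norm_sub_rev] at h2
  linarith

/-- Moving the functional in the direction `ζ` moves near maximizers in the direction `ζ`. -/
theorem apply_sub_le (h : IsTiltable C F b M) {ξ ζ : StrongDual ℝ X} {s α β : ℝ} {x z : X}
    (hx : x ∈ nearMax C F b ξ α) (hz : z ∈ nearMax C F b (ξ + s • ζ) β) :
    s * (ζ x - ζ z) ≤ α + β := by
  have h1 := h.le_tiltedSup ξ hz.1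
  have h2 := h.le_tiltedSup (ξ + s • ζ) hx.1
  have h3 := hx.2
  have h4 := hz.2
  simp only [add_apply, smul_apply, smul_eq_mul,
    map_sub] at h1 h2 h3 h4
  linarith

/-! ### Stegall's variational principle -/

/-- Near every functional there is one whose near maximizers form a set of small diameter,
provided the closed convex hull of `C` has only dentable subsets. -/
theorem exists_nearMax_small [CompleteSpace X] (h : IsTiltable C F b M)
    (hdent : ∀ A ⊆ closedConvexHull ℝ C, A.Nonempty → IsDentable A)
    (ξ₀ : StrongDual ℝ X) {ε η : ℝ} (hε : 0 < ε) (hη : 0 < η) :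
    ∃ ξ : StrongDual ℝ X, ‖ξ - ξ₀‖ < ε ∧ ∃ α : ℝ, 0 < α ∧
      ∀ x ∈ nearMax C F b ξ α, ∀ y ∈ nearMax C F b ξ α, dist x y < η := by
  by_contra! hcon
  -- The tolerance is proportional to the slack ε - ‖ξ - ξ₀‖, so a tilt using up at most half the
  -- slack still leads from `A n` into `A (n + 1)`.
  set A : ℕ → Set X := fun n => {x | ∃ ξ : StrongDual ℝ X, ‖ξ - ξ₀‖ < ε ∧
    x ∈ nearMax C F b ξ ((1 / 2) ^ n * (ε - ‖ξ - ξ₀‖))} with hAdef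
  have hanti : Antitone A := by
    rintro m n hmn x ⟨ξ, hξ, hx, hx'⟩
    refine ⟨ξ, hξ, hx, ?_⟩
    have h1 : ((1 : ℝ) / 2) ^ n ≤ (1 / 2) ^ m :=
      pow_le_pow_of_le_one (by norm_num) (by norm_num) hmn
    have := mul_le_mul_of_nonneg_right h1 (sub_pos.2 hξ).le
    linarith
  have hAC : ∀ n, A n ⊆ C := by
    rintro n x ⟨ξ, -, hx, -⟩
    exact hx
  have hfar : ∀ n, ∀ x ∈ A n, ∀ ζ : StrongDual ℝ X, ∃ z ∈ A (n + 1),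
      ζ x ≤ ζ z + 4 * (1 / 2) ^ n * ‖ζ‖ ∧ η / 2 ≤ dist x z := by
    rintro n x ⟨ξ, hξ, hx⟩ ζ
    set d := ε - ‖ξ - ξ₀‖ with hd
    have hd0 : 0 < d := sub_pos.2 hξ
    -- For ζ = 0 division by zero makes s = 0, which is harmless: z is still far from x.
    set c : ℝ := (1 / 2) ^ n with hc
    have hc0 : 0 < c := by positivity
    set s := d / (2 * ‖ζ‖) with hs
    have hsζ : ‖s • ζ‖ ≤ d / 2 := by
      rw [norm_smul, Real.norm_of_nonneg (by positivity), hs]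
      rcases eq_or_ne ‖ζ‖ 0 with h0 | h0
      · rw [h0]
        simpa using (half_pos hd0).le
      · field_simp
        exact le_rfl
    have hξ' : ‖ξ + s • ζ - ξ₀‖ ≤ ε - d / 2 := by
      have h1 : ξ + s • ζ - ξ₀ = (ξ - ξ₀) + s • ζ := by abel
      rw [h1]
      have := norm_add_le (ξ - ξ₀) (s • ζ)
      linarith
    obtain ⟨z₁, hz₁, z₂, hz₂, hz⟩ := hcon (ξ + s • ζ) (by linarith) (c * d / 4) (by positivity)
    have hfar' : ∃ z ∈ nearMax C F b (ξ + s • ζ) (c * d / 4), η / 2 ≤ dist x z := by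
      by_contra! hclose
      have h1 := hclose z₁ hz₁
      have h2 := hclose z₂ hz₂
      have h3 := dist_triangle_left z₁ z₂ x
      linarith
    obtain ⟨z, hzm, hxz⟩ := hfar'
    refine ⟨z, ⟨ξ + s • ζ, by linarith, hzm.1, ?_⟩, ?_, hxz⟩
    · have h1 := hzm.2
      have h2 : c * d / 4 ≤ (1 / 2) ^ (n + 1) * (ε - ‖ξ + s • ζ - ξ₀‖) := by
        rw [pow_succ, ← hc]
        nlinarith
      linarith
    · have h1 := h.apply_sub_le hx hzm
      rcases eq_or_ne ‖ζ‖ 0 with h0 | h0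
      · rw [norm_eq_zero] at h0
        simp [h0]
      · have h0' : 0 < ‖ζ‖ := lt_of_le_of_ne (norm_nonneg _) h0.symm
        rw [hs, div_mul_eq_mul_div, div_le_iff₀ (by positivity)] at h1
        have h2 : d * (ζ x - ζ z) ≤ d * (4 * c * ‖ζ‖) := by
          have : 0 < c * d * ‖ζ‖ := by positivity
          nlinarith
        have := le_of_mul_le_mul_left h2 hd0
        linarith
  set L := ⋂ n, closedConvexHull ℝ (A n) with hL
  have hgeom : ∀ n : ℕ, ∑' m : ℕ, 2 * (4 * ((1 : ℝ) / 2) ^ (n + m)) = 16 * (1 / 2) ^ n := by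
    intro n
    have : ∀ m : ℕ, 2 * (4 * ((1 : ℝ) / 2) ^ (n + m)) = 8 * (1 / 2) ^ n * (1 / 2) ^ m := by
      intro m
      rw [pow_add]
      ring
    rw [tsum_congr this, tsum_mul_left, tsum_geometric_two]
    ring
  have hnear : ∀ n, ∀ x ∈ A n, ∃ y ∈ L, dist x y ≤ 16 * (1 / 2) ^ n := by
    intro n x hx
    obtain ⟨y, hy, hxy⟩ := exists_mem_iInter_closedConvexHull (A := fun m => A (n + m))
      (κ := fun m => 4 * (1 / 2) ^ (n + m)) (fun i j hij => hanti (by omega))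
      (fun m => by positivity)
      (by
        simp only [pow_add]
        exact (summable_geometric_two.mul_left _).mul_left _)
      (fun m w hw ζ => by
        obtain ⟨z, hz, hz', -⟩ := hfar (n + m) w hw ζ
        exact ⟨z, hz, hz'⟩) (x := x) hx
    refine ⟨y, Set.mem_iInter.2 fun k => ?_, hxy.trans_eq (hgeom n)⟩
    exact (closedConvexHull ℝ).monotone (hanti (by omega)) (Set.mem_iInter.1 hy k)
  have hLC : L ⊆ closedConvexHull ℝ C :=
    (Set.iInter_subset _ 0).trans ((closedConvexHull ℝ).monotone (hAC 0))
  have hLne : L.Nonempty := by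
    obtain ⟨x, hx⟩ := h.nearMax_nonempty ξ₀ hε
    obtain ⟨y, hy, -⟩ := hnear 0 x ⟨ξ₀, by simpa using hε, by simpa using hx⟩
    exact ⟨y, hy⟩
  have hballC : closedConvexHull ℝ C ⊆ Metric.closedBall b M :=
    closedConvexHull_min (fun x hx => by
      rw [Metric.mem_closedBall, dist_eq_norm]
      exact h.norm_le x hx) (convex_closedBall b M) Metric.isClosed_closedBall
  -- A small slice of L is contradicted by points x, z of `A n` at distance at least η/2 and low for
  -- ζ: their approximants in L both fall in the slice.
  obtain ⟨δ, hδ, ζ, hdiam⟩ := hdent L hLC hLne (η / 8) (by positivity)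
  have hbddL : Bornology.IsBounded L := Metric.isBounded_closedBall.subset (hLC.trans hballC)
  have hslice : ∀ x ∈ L, ∀ y ∈ L, ζ x < sInf (ζ '' L) + δ → ζ y < sInf (ζ '' L) + δ →
      dist x y < η / 8 := fun x hx y hy h1 h2 =>
    (Metric.dist_le_diam_of_mem (hbddL.subset fun _ hv => hv.1)
      (show x ∈ dualSlice L ζ δ from ⟨hx, h1⟩) (show y ∈ dualSlice L ζ δ from ⟨hy, h2⟩)).trans_lt hdiam
  obtain ⟨n, hn⟩ : ∃ n : ℕ, ((1 : ℝ) / 2) ^ n < min (δ / (40 * (‖ζ‖ + 1))) (η / 200) :=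
    exists_pow_lt_of_lt_one (by positivity) (by norm_num)
  have hn1 := hn.trans_le (min_le_left _ _)
  have hn2 := hn.trans_le (min_le_right _ _)
  rw [lt_div_iff₀ (by positivity)] at hn1
  set c : ℝ := (1 / 2) ^ n with hc
  have hc0 : 0 < c := by positivity
  obtain ⟨_, ⟨y, hy, rfl⟩, hyI⟩ := exists_lt_of_csInf_lt (hLne.image ζ)
    (show sInf (ζ '' L) < sInf (ζ '' L) + δ / 4 by linarith)
  obtain ⟨x, hx, hxI⟩ := exists_lt_of_mem_closedConvexHull (Set.mem_iInter.1 hy n) ζ hyI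
  obtain ⟨z, hz, hzx, hxz⟩ := hfar n x hx (-ζ)
  simp only [neg_apply, norm_neg, ← hc] at hzx
  obtain ⟨x', hx', hxx'⟩ := hnear n x hx
  obtain ⟨z', hz', hzz'⟩ := hnear n z (hanti (Nat.le_succ n) hz)
  have hmove : ∀ v w : X, dist v w ≤ 16 * c → ζ w ≤ ζ v + ‖ζ‖ * (16 * c) := by
    intro v w hvw
    have h1 := (le_abs_self _).trans (ζ.le_opNorm (w - v))
    rw [map_sub, ← dist_eq_norm, dist_comm] at h1
    have := mul_le_mul_of_nonneg_left hvw (norm_nonneg ζ)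
    linarith
  have h1 := hmove x x' hxx'
  have h2 := hmove z z' hzz'
  have h3 : 0 ≤ c * ‖ζ‖ := by positivity
  have h4 := hslice x' hx' z' hz' (by nlinarith) (by nlinarith)
  have h5 := dist_triangle4 x x' z' z
  rw [dist_comm z' z] at h5
  linarith

/-- Stegall's variational principle: a lower semicontinuous function on a set whose closed convex
hull has only dentable subsets has strong maximizers after arbitrarily small linear tilts. -/
theorem dense_strongMax [CompleteSpace X] (h : IsTiltable C F b M)
    (hclosed : ∀ a, IsClosed {x | x ∈ C ∧ F x ≤ a})
    (hdent : ∀ A ⊆ closedConvexHull ℝ C, A.Nonempty → IsDentable A) :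
    Dense {ξ : StrongDual ℝ X | ∃ x ∈ C, tiltedSup C F b ξ = ξ (x - b) - F x ∧
      ∀ η : ℝ, 0 < η → ∃ α : ℝ, 0 < α ∧ ∀ y ∈ nearMax C F b ξ α, dist y x < η} := by
  set G : ℕ → Set (StrongDual ℝ X) := fun k => {ξ | ∃ α : ℝ, 0 < α ∧
    ∀ x ∈ nearMax C F b ξ α, ∀ y ∈ nearMax C F b ξ α, dist x y < 1 / ((k : ℝ) + 1)} with hG
  have hM := h.radius_nonneg
  have hopen : ∀ k, IsOpen (G k) := by
    intro k
    rw [Metric.isOpen_iff]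
    rintro ξ ⟨α, hα, hsmall⟩
    refine ⟨α / (4 * (M + 1)), by positivity, fun ζ hζ => ⟨α / 2, by positivity, ?_⟩⟩
    have hsub : nearMax C F b ζ (α / 2) ⊆ nearMax C F b ξ α := by
      refine h.nearMax_subset ?_
      rw [Metric.mem_ball, dist_eq_norm, norm_sub_rev, lt_div_iff₀ (by positivity)] at hζ
      have := norm_nonneg (ξ - ζ)
      nlinarith
    exact fun x hx y hy => hsmall x (hsub hx) y (hsub hy)
  have hdense : ∀ k, Dense (G k) := by
    intro k
    rw [Metric.dense_iff]
    intro ξ₀ ε hε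
    obtain ⟨ξ, hξ, hξG⟩ := h.exists_nearMax_small hdent ξ₀ hε
      (show (0 : ℝ) < 1 / ((k : ℝ) + 1) by positivity)
    exact ⟨ξ, by rwa [Metric.mem_ball, dist_eq_norm], hξG⟩
  -- Baire category in the dual space; in the intersection, near-maximizer sets shrink to diameter
  -- zero.
  refine (dense_iInter_of_isOpen_nat hopen hdense).mono fun ξ hξ => ?_
  have hsmall : ∀ η : ℝ, 0 < η → ∃ α : ℝ, 0 < α ∧
      ∀ x ∈ nearMax C F b ξ α, ∀ y ∈ nearMax C F b ξ α, dist x y < η := by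
    intro η hη
    obtain ⟨k, hk⟩ := exists_nat_one_div_lt hη
    obtain ⟨α, hα, hd⟩ := Set.mem_iInter.1 hξ k
    exact ⟨α, hα, fun x hx y hy => (hd x hx y hy).trans hk⟩
  have hmono : ∀ {α β : ℝ}, α ≤ β → nearMax C F b ξ α ⊆ nearMax C F b ξ β :=
    fun hαβ x hx => ⟨hx.1, by linarith [hx.2]⟩
  choose u hu using fun k : ℕ =>
    h.nearMax_nonempty ξ (show (0 : ℝ) < 1 / ((k : ℝ) + 1) by positivity)
  have hev : ∀ α : ℝ, 0 < α → ∀ᶠ k in atTop, u k ∈ nearMax C F b ξ α := by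
    intro α hα
    filter_upwards [tendsto_one_div_add_atTop_nhds_zero_nat.eventually (gt_mem_nhds hα)] with k hk
    exact hmono hk.le (hu k)
  have hcauchy : CauchySeq u := by
    rw [Metric.cauchySeq_iff]
    intro η hη
    obtain ⟨α, hα, hd⟩ := hsmall η hη
    obtain ⟨N, hN⟩ := eventually_atTop.1 (hev α hα)
    exact ⟨N, fun m hm n hn => hd _ (hN m hm) _ (hN n hn)⟩
  obtain ⟨x, hx⟩ := cauchySeq_tendsto_of_complete hcauchy
  have hlim : Tendsto (fun k => ξ (u k - b)) atTop (𝓝 (ξ (x - b))) :=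
    (ξ.continuous.tendsto _).comp (hx.sub_const b)
  -- C need not be closed, but near maximizers eventually lie in one closed sublevel set.
  have hF : ∀ ε : ℝ, 0 < ε → x ∈ C ∧ F x ≤ ξ (x - b) - tiltedSup C F b ξ + ε := by
    intro ε hε
    refine (hclosed _).mem_of_tendsto hx ?_
    filter_upwards [hev (ε / 2) (by positivity),
      hlim.eventually (gt_mem_nhds (show ξ (x - b) < ξ (x - b) + ε / 2 by linarith))] with k hk hk'
    exact ⟨hk.1, by linarith [hk.2]⟩
  have hxC : x ∈ C := (hF 1 one_pos).1
  refine ⟨x, hxC, le_antisymm ?_ (h.le_tiltedSup ξ hxC), fun η hη => ?_⟩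
  · have : F x ≤ ξ (x - b) - tiltedSup C F b ξ :=
      le_of_forall_pos_le_add fun ε hε => (hF ε hε).2
    linarith
  · obtain ⟨α, hα, hd⟩ := hsmall (η / 2) (by positivity)
    refine ⟨α, hα, fun y hy => ?_⟩
    have hle : dist y x ≤ η / 2 := by
      refine le_of_tendsto (tendsto_const_nhds.dist hx) ?_
      filter_upwards [hev α hα] with k hk
      exact (hd y hy _ hk).le
    linarith

end IsTiltable

/-! ### From the error bound to growth -/

namespace IsTiltable

variable {X : Type*} [NormedAddCommGroup X] [NormedSpace ℝ X] {C : Set X} {F : X → ℝ} {b : X}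
  {M : ℝ}

/-- The error bound controls the tilted supremum along rays, up to its slope at the origin. -/
theorem tiltedSup_le_two_mul (h : IsTiltable C F b M) {q μ : ℝ} (hq : 0 < q)
    (hdense : Dense {ξ : StrongDual ℝ X | ∃ x ∈ C, tiltedSup C F b ξ = ξ (x - b) - F x})
    (hEB : ∀ x ∈ C, ∀ ξ : StrongDual ℝ X, tiltedSup C F b ξ = ξ (x - b) - F x →
      F x ≤ μ * ‖ξ‖ ^ q) (ξ : StrongDual ℝ X) :
    tiltedSup C F b ξ ≤ 2 * tiltedSup C F b ((1 / 2 : ℝ) • ξ) + μ * ‖ξ‖ ^ q := by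
  have hcl : IsClosed {ξ : StrongDual ℝ X |
      tiltedSup C F b ξ ≤ 2 * tiltedSup C F b ((1 / 2 : ℝ) • ξ) + μ * ‖ξ‖ ^ q} := by
    have hc := h.continuous_tiltedSup
    refine isClosed_le hc (((hc.comp (continuous_const_smul _)).const_mul 2).add ?_)
    exact (continuous_norm.rpow_const fun _ => Or.inr hq.le).const_mul μ
  refine hcl.closure_subset_iff.2 ?_ (hdense ξ)
  rintro ζ ⟨x, hx, hζ⟩
  -- Uses ζ(x - b) - F x = 2(ζ(x - b)/2 - F x) + F x.
  have h1 := hEB x hx ζ hζ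
  have h2 := h.le_tiltedSup ((1 / 2 : ℝ) • ζ) hx
  simp only [smul_apply, smul_eq_mul] at h2
  simp only [Set.mem_ofPred_eq]
  linarith

/-- The errors of repeated halving form a geometric series of ratio 2·2^(-q); the condition on c
makes it a bound for the sum. -/
theorem tiltedSup_le_two_pow_mul (h : IsTiltable C F b M) {q μ c : ℝ} (hq : 0 < q)
    (hdense : Dense {ξ : StrongDual ℝ X | ∃ x ∈ C, tiltedSup C F b ξ = ξ (x - b) - F x})
    (hEB : ∀ x ∈ C, ∀ ξ : StrongDual ℝ X, tiltedSup C F b ξ = ξ (x - b) - F x →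
      F x ≤ μ * ‖ξ‖ ^ q) (hc0 : 0 ≤ c) (hc : μ + c * (2 * (1 / 2) ^ q) ≤ c) (n : ℕ)
    (ξ : StrongDual ℝ X) :
    tiltedSup C F b ξ ≤ 2 ^ n * tiltedSup C F b ((1 / 2 : ℝ) ^ n • ξ) + c * ‖ξ‖ ^ q := by
  induction n generalizing ξ with
  | zero =>
    have : 0 ≤ c * ‖ξ‖ ^ q := by positivity
    simpa using this
  | succ n ih =>
    have h1 := h.tiltedSup_le_two_mul hq hdense hEB ξ
    have h2 := ih ((1 / 2 : ℝ) • ξ)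
    rw [norm_smul, smul_smul, ← pow_succ, Real.mul_rpow (norm_nonneg _) (norm_nonneg _),
      Real.norm_of_nonneg (by norm_num)] at h2
    have h3 := mul_le_mul_of_nonneg_right hc (Real.rpow_nonneg (norm_nonneg ξ) q)
    rw [pow_succ (2 : ℝ)]
    linarith

/-- Under the error bound, each functional takes on every sublevel set values almost as large as
at a given point. -/
theorem exists_le_apply_add (h : IsTiltable C F b M) {p q μ c : ℝ} (hq : 0 < q)
    (hpq : p⁻¹ + q⁻¹ = 1) (hb : b ∈ C) (hFb : F b = 0)
    (hdense : Dense {ξ : StrongDual ℝ X | ∃ x ∈ C, tiltedSup C F b ξ = ξ (x - b) - F x})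
    (hEB : ∀ x ∈ C, ∀ ξ : StrongDual ℝ X, tiltedSup C F b ξ = ξ (x - b) - F x →
      F x ≤ μ * ‖ξ‖ ^ q) (hc0 : 0 ≤ c) (hc : μ + c * (2 * (1 / 2) ^ q) ≤ c)
    {δ δ' : ℝ} (hδ : 0 < δ) (hδ' : 0 < δ') {x : X} (hx : x ∈ C) (hxδ : F x ≤ δ)
    (ξ : StrongDual ℝ X) :
    ∃ z, (z ∈ C ∧ F z ≤ δ') ∧ ξ x ≤ ξ z + (c + 2) * δ ^ p⁻¹ * ‖ξ‖ := by
  rcases eq_or_ne ξ 0 with rfl | hξ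
  · exact ⟨b, ⟨hb, hFb.trans_le hδ'.le⟩, by simp⟩
  have hξ0 : 0 < ‖ξ‖ := norm_pos_iff.2 hξ
  have hM := h.radius_nonneg
  set e := δ ^ p⁻¹ * ‖ξ‖ with he
  have he0 : 0 < e := by positivity
  -- This scale balances the errors: ‖tξ‖^q and te both equal δ.
  set t := δ ^ q⁻¹ / ‖ξ‖ with ht
  have ht0 : 0 < t := by positivity
  have hte : t * e = δ := by
    rw [ht, he, div_mul_eq_mul_div, div_eq_iff hξ0.ne', mul_comm (δ ^ p⁻¹), mul_left_comm,
      ← Real.rpow_add hδ, add_comm, hpq, Real.rpow_one, mul_comm]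
  have htq : ‖t • ξ‖ ^ q = δ := by
    rw [norm_smul, Real.norm_of_nonneg ht0.le, ht, div_mul_cancel₀ _ hξ0.ne',
      ← Real.rpow_mul hδ.le, inv_mul_cancel₀ hq.ne', Real.rpow_one]
  obtain ⟨n, hn⟩ : ∃ n : ℕ, ((1 : ℝ) / 2) ^ n < δ' / (t * (‖ξ‖ * M + e)) :=
    exists_pow_lt_of_lt_one (by positivity) (by norm_num)
  rw [lt_div_iff₀ (by positivity)] at hn
  set r : ℝ := (1 / 2) ^ n with hr
  have hr0 : 0 < r := by positivity
  have h2r : 2 ^ n * r = 1 := by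
    rw [hr, ← mul_pow]
    norm_num
  -- The tolerance is scaled by r, so after multiplication by 2^n it costs only te = δ, and F z ≤
  -- rt(‖ξ‖M + e) < δ'.
  obtain ⟨z, hzC, hz⟩ := h.nearMax_nonempty (r • t • ξ) (show 0 < r * t * e by positivity)
  have h0 := h.le_tiltedSup (r • t • ξ) hb
  have hFz := h.nonneg z hzC
  have hξz := h.apply_le ξ hzC
  simp only [smul_apply, smul_eq_mul] at hz h0
  rw [sub_self, map_zero, hFb] at h0
  refine ⟨z, ⟨hzC, ?_⟩, ?_⟩
  · have := mul_le_mul_of_nonneg_left hξz (mul_pos hr0 ht0).le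
    nlinarith
  · have h1 := h.tiltedSup_le_two_pow_mul hq hdense hEB hc0 hc n (t • ξ)
    have h2 := h.le_tiltedSup (t • ξ) hx
    rw [htq, ← hr] at h1
    simp only [smul_apply, smul_eq_mul] at h2
    have h3 : 2 ^ n * tiltedSup C F b (r • t • ξ) ≤ t * (ξ (z - b) + e) := by
      have h4 : tiltedSup C F b (r • t • ξ) ≤ r * (t * (ξ (z - b) + e)) := by linarith
      calc 2 ^ n * tiltedSup C F b (r • t • ξ) ≤ 2 ^ n * (r * (t * (ξ (z - b) + e))) := by gcongr
        _ = t * (ξ (z - b) + e) := by rw [← mul_assoc, h2r, one_mul]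
    have h5 : t * ξ (x - b) ≤ t * (ξ (z - b) + (c + 2) * e) := by
      have : t * (ξ (z - b) + (c + 2) * e) = t * (ξ (z - b) + e) + (c + 1) * (t * e) := by ring
      rw [this, hte]
      linarith
    have h6 := le_of_mul_le_mul_left h5 ht0
    rw [map_sub, map_sub] at h6
    rw [mul_assoc]
    linarith

/-- Under the error bound, sublevel sets are close to the intersection of the closed convex hulls
of all sublevel sets. -/
theorem exists_mem_hull_sublevel [CompleteSpace X] (h : IsTiltable C F b M) {p q μ : ℝ}
    (hp : 1 < p) (hq : 1 < q) (hpq : p⁻¹ + q⁻¹ = 1) (hμ : 0 < μ) (hb : b ∈ C) (hFb : F b = 0)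
    (hdense : Dense {ξ : StrongDual ℝ X | ∃ x ∈ C, tiltedSup C F b ξ = ξ (x - b) - F x})
    (hEB : ∀ x ∈ C, ∀ ξ : StrongDual ℝ X, tiltedSup C F b ξ = ξ (x - b) - F x →
      F x ≤ μ * ‖ξ‖ ^ q) :
    ∃ K : ℝ, 0 < K ∧ ∀ δ : ℝ, 0 < δ → ∀ x ∈ C, F x ≤ δ →
      ∃ y, (∀ δ' : ℝ, 0 < δ' → y ∈ closedConvexHull ℝ {x | x ∈ C ∧ F x ≤ δ'}) ∧
        dist x y ≤ K * δ ^ p⁻¹ := by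
  have hhalf : 2 * ((1 : ℝ) / 2) ^ q < 1 := by
    have := Real.rpow_lt_rpow_of_exponent_gt (x := (1 : ℝ) / 2) (by norm_num) (by norm_num) hq
    rw [Real.rpow_one] at this
    linarith
  -- Sum of the halving errors; it converges because q > 1.
  set c := μ / (1 - 2 * ((1 : ℝ) / 2) ^ q) with hcdef
  have hc0 : 0 ≤ c := div_nonneg hμ.le (sub_pos.2 hhalf).le
  have hc : μ + c * (2 * (1 / 2) ^ q) ≤ c := by
    have : c * (1 - 2 * ((1 : ℝ) / 2) ^ q) = μ := div_mul_cancel₀ _ (sub_pos.2 hhalf).ne'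
    linarith
  set ρ : ℝ := (1 / 2) ^ p⁻¹ with hρ
  have hρ0 : 0 < ρ := by positivity
  have hρ1 : ρ < 1 := Real.rpow_lt_one (by norm_num) (by norm_num) (by positivity)
  refine ⟨2 * (c + 2) * (1 - ρ)⁻¹, mul_pos (by positivity) (inv_pos.2 (sub_pos.2 hρ1)),
    fun δ hδ x hx hxδ => ?_⟩
  have hpow : ∀ n : ℕ, (δ * (1 / 2) ^ n) ^ p⁻¹ = δ ^ p⁻¹ * ρ ^ n := by
    intro n
    rw [Real.mul_rpow hδ.le (by positivity), hρ, ← Real.rpow_natCast, ← Real.rpow_natCast,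
      ← Real.rpow_mul (by norm_num), ← Real.rpow_mul (by norm_num), mul_comm p⁻¹]
  have hsumm : Summable fun n : ℕ => ρ ^ n := summable_geometric_of_lt_one hρ0.le hρ1
  obtain ⟨y, hy, hxy⟩ := exists_mem_iInter_closedConvexHull
    (A := fun n : ℕ => {x | x ∈ C ∧ F x ≤ δ * (1 / 2) ^ n})
    (κ := fun n : ℕ => (c + 2) * δ ^ p⁻¹ * ρ ^ n)
    (by
      rintro m n hmn w ⟨hw, hw'⟩
      have h1 : ((1 : ℝ) / 2) ^ n ≤ (1 / 2) ^ m :=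
        pow_le_pow_of_le_one (by norm_num) (by norm_num) hmn
      exact ⟨hw, hw'.trans (mul_le_mul_of_nonneg_left h1 hδ.le)⟩)
    (fun n => by positivity) (hsumm.mul_left _)
    (by
      rintro n w ⟨hw, hw'⟩ ξ
      obtain ⟨z, hz, hz'⟩ := h.exists_le_apply_add (by positivity) hpq hb hFb hdense hEB hc0 hc
        (show 0 < δ * (1 / 2) ^ n by positivity) (show 0 < δ * (1 / 2) ^ (n + 1) by positivity)
        hw hw' ξ
      refine ⟨z, hz, ?_⟩
      rwa [hpow, ← mul_assoc (c + 2)] at hz')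
    (x := x) ⟨hx, by simpa using hxδ⟩
  refine ⟨y, fun δ' hδ' => ?_, hxy.trans_eq ?_⟩
  · obtain ⟨n, hn⟩ : ∃ n : ℕ, ((1 : ℝ) / 2) ^ n < δ' / δ :=
      exists_pow_lt_of_lt_one (by positivity) (by norm_num)
    rw [lt_div_iff₀ hδ] at hn
    refine (closedConvexHull ℝ).monotone ?_ (Set.mem_iInter.1 hy n)
    rintro w ⟨hw, hw'⟩
    exact ⟨hw, by linarith⟩
  · simp only [← mul_assoc]
    rw [tsum_mul_left, tsum_geometric_of_lt_one hρ0.le hρ1]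
    ring

/-- The error bound for the tilted maxima of a function with a strict minimum implies growth of
order `p`. -/
theorem growth_of_errorBound [CompleteSpace X] (h : IsTiltable C F b M) {p q μ : ℝ}
    (hp : 1 < p) (hq : 1 < q) (hpq : p⁻¹ + q⁻¹ = 1) (hμ : 0 < μ) (hb : b ∈ C) (hFb : F b = 0)
    (hstrict : ∀ x ∈ C, F x ≤ 0 → x = b) (hclosed : ∀ a, IsClosed {x | x ∈ C ∧ F x ≤ a})
    (hdent : ∀ A ⊆ closedConvexHull ℝ C, A.Nonempty → IsDentable A)
    (hEB : ∀ x ∈ C, ∀ ξ : StrongDual ℝ X, tiltedSup C F b ξ = ξ (x - b) - F x →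
      F x ≤ μ * ‖ξ‖ ^ q) :
    ∃ γ : ℝ, 0 < γ ∧ ∀ x ∈ C, γ * ‖x - b‖ ^ p ≤ F x := by
  have hp0 : 0 < p := by linarith
  obtain ⟨K, hK, hnear⟩ := h.exists_mem_hull_sublevel hp hq hpq hμ hb hFb
    ((h.dense_strongMax hclosed hdent).mono (by
      rintro ξ ⟨x, hx, hξ, -⟩
      exact ⟨x, hx, hξ⟩)) hEB
  set S : Set X := {y | ∀ δ : ℝ, 0 < δ → y ∈ closedConvexHull ℝ {x | x ∈ C ∧ F x ≤ δ}} with hS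
  have hbS : b ∈ S := fun δ hδ => subset_closedConvexHull ⟨hb, hFb.trans_le hδ.le⟩
  have hSC : S ⊆ closedConvexHull ℝ C := fun y hy =>
    (closedConvexHull ℝ).monotone (fun _ hx => hx.1) (hy 1 one_pos)
  have hSclosed : IsClosed S := by
    simp only [hS, Set.ofPred_forall]
    exact isClosed_iInter fun δ => isClosed_iInter fun _ => isClosed_closedConvexHull
  have hballC : closedConvexHull ℝ C ⊆ Metric.closedBall b M :=
    closedConvexHull_min (fun x hx => by
      rw [Metric.mem_closedBall, dist_eq_norm]
      exact h.norm_le x hx) (convex_closedBall b M) Metric.isClosed_closedBall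
  have hStilt : IsTiltable S (fun _ => 0) b M :=
    ⟨⟨b, hbS⟩, fun _ _ => le_rfl, fun x hx => by
      simpa [dist_eq_norm] using hballC (hSC hx)⟩
  have hShull : closedConvexHull ℝ S ⊆ closedConvexHull ℝ C :=
    closedConvexHull_min hSC convex_closedConvexHull isClosed_closedConvexHull
  have hSb : ∀ y ∈ S, y = b := by
    intro y hy
    by_contra hyb
    obtain ⟨ξ₀, -, hξ₀⟩ := exists_dual_vector ℝ (y - b) (norm_ne_zero_iff.2 (sub_ne_zero.2 hyb))
    have hpos : 0 < ξ₀ (y - b) := by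
      rw [hξ₀]
      exact norm_pos_iff.2 (sub_ne_zero.2 hyb)
    have hopen : IsOpen {ξ : StrongDual ℝ X | 0 < ξ (y - b)} :=
      isOpen_lt continuous_const (by fun_prop)
    obtain ⟨ξ, hξy, s, hs, hmax, hstrong⟩ := (hStilt.dense_strongMax
      (fun a => by
        by_cases ha : (0 : ℝ) ≤ a
        · simpa [ha] using hSclosed
        · simp [ha])
      (fun A hA => hdent A (hA.trans hShull))).inter_open_nonempty _ hopen ⟨ξ₀, hpos⟩
    have hsy := hStilt.le_tiltedSup ξ hy
    simp only [Set.mem_ofPred_eq] at hξy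
    rw [hmax] at hsy
    have happrox : ∀ η : ℝ, 0 < η → ∃ x, (x ∈ C ∧ F x ≤ η) ∧ dist x s < η := by
      intro η hη
      obtain ⟨α, hα, hd⟩ := hstrong (η / 2) (by positivity)
      -- R keeps x within η/2 of w ∈ S and changes ξ by less than α/2, so w stays a near maximizer.
      set R := min (η / 2) (α / (2 * (‖ξ‖ + 1))) with hR
      have hR0 : 0 < R := by positivity
      set δ := min η ((R / (2 * K)) ^ p) with hδdef
      have hδ0 : 0 < δ := by positivity
      have hδR : K * δ ^ p⁻¹ < R := by
        have h1 : δ ^ p⁻¹ ≤ ((R / (2 * K)) ^ p) ^ p⁻¹ :=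
          Real.rpow_le_rpow hδ0.le (min_le_right _ _) (by positivity)
        rw [← Real.rpow_mul (by positivity), mul_inv_cancel₀ hp0.ne', Real.rpow_one] at h1
        calc K * δ ^ p⁻¹ ≤ K * (R / (2 * K)) := by gcongr
          _ = R / 2 := by field_simp
          _ < R := by linarith
      obtain ⟨x, ⟨hx, hxδ⟩, hxs⟩ := exists_lt_of_mem_closedConvexHull (hs δ hδ0) (-ξ)
        (c := -ξ s + α / 2) (by rw [neg_apply]; linarith)
      rw [neg_apply] at hxs
      obtain ⟨w, hw, hxw⟩ := hnear δ hδ0 x hx hxδ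
      have hRα : R ≤ α / (2 * (‖ξ‖ + 1)) := min_le_right _ _
      rw [le_div_iff₀ (by positivity)] at hRα
      have hξw : ξ x - ξ w ≤ ‖ξ‖ * R := by
        have h1 := (le_abs_self _).trans (ξ.le_opNorm (x - w))
        rw [map_sub, ← dist_eq_norm] at h1
        exact h1.trans (mul_le_mul_of_nonneg_left (hxw.trans hδR.le) (norm_nonneg _))
      have hwnear : w ∈ nearMax S (fun _ => 0) b ξ α := by
        refine ⟨hw, ?_⟩
        rw [hmax, map_sub, map_sub]
        linarith
      refine ⟨x, ⟨hx, hxδ.trans (min_le_left _ _)⟩, ?_⟩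
      have h1 := hd w hwnear
      have h2 := dist_triangle x w s
      have h3 : R ≤ η / 2 := min_le_left _ _
      linarith
    have hsF : ∀ a : ℝ, 0 < a → s ∈ C ∧ F s ≤ a := by
      intro a ha
      refine (hclosed a).closure_subset (Metric.mem_closure_iff.2 fun ε hε => ?_)
      obtain ⟨x, ⟨hx, hxF⟩, hxs⟩ := happrox (min a ε) (lt_min ha hε)
      refine ⟨x, ⟨hx, hxF.trans (min_le_left _ _)⟩, ?_⟩
      rw [dist_comm]
      exact hxs.trans_le (min_le_right _ _)
    have hsb : s = b := hstrict s (hsF 1 one_pos).1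
      (le_of_forall_pos_le_add fun ε hε => by simpa using (hsF ε hε).2)
    rw [hsb, sub_self, map_zero] at hsy
    linarith
  refine ⟨(K ^ p)⁻¹, by positivity, fun x hx => ?_⟩
  rcases (h.nonneg x hx).eq_or_lt with h0 | h0
  · rw [hstrict x hx h0.ge, sub_self, norm_zero, Real.zero_rpow hp0.ne', mul_zero, hFb]
  · obtain ⟨y, hy, hxy⟩ := hnear (F x) h0 x hx le_rfl
    rw [hSb y hy, dist_eq_norm] at hxy
    have h1 := Real.rpow_le_rpow (norm_nonneg _) hxy hp0.le
    rw [Real.mul_rpow hK.le (by positivity), ← Real.rpow_mul h0.le, inv_mul_cancel₀ hp0.ne',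
      Real.rpow_one] at h1
    rwa [inv_mul_le_iff₀ (by positivity)]

end IsTiltable

/-! ### From growth to the error bound, and the equivalence -/

/-- A function with growth of order `p` at a minimizer satisfies the error bound of the conjugate
order at each point with a subgradient. -/
theorem le_mul_rpow_of_growth {p q γ a r N : ℝ} (hp : 1 < p) (hq : 1 < q)
    (hpq : p⁻¹ + q⁻¹ = 1) (hγ : 0 < γ) (hr : 0 ≤ r) (hN : 0 ≤ N) (h1 : γ * r ^ p ≤ a)
    (h2 : a ≤ N * r) : a ≤ γ ^ (-(q / p)) * N ^ q := by
  have hp0 : 0 < p := by linarith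
  have hq0 : 0 < q := by linarith
  have ha : 0 ≤ a := le_trans (by positivity) h1
  rcases ha.eq_or_lt with ha0 | ha0
  · rw [← ha0]
    positivity
  have hrle : r ≤ (a / γ) ^ p⁻¹ := by
    rw [Real.le_rpow_inv_iff_of_pos hr (by positivity) hp0, le_div_iff₀ hγ, mul_comm]
    exact h1
  have h3 : a ≤ N * (a / γ) ^ p⁻¹ := h2.trans (by gcongr)
  -- Cancel a^(1/p) in a = a^(1/q) a^(1/p).
  have h4 : a ^ q⁻¹ ≤ N * γ ^ (-p⁻¹) := by
    rw [Real.div_rpow ha hγ.le] at h3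
    have h5 : a = a ^ q⁻¹ * a ^ p⁻¹ := by
      rw [← Real.rpow_add ha0, add_comm, hpq, Real.rpow_one]
    have h6 : a ^ q⁻¹ * a ^ p⁻¹ ≤ N * γ ^ (-p⁻¹) * a ^ p⁻¹ := by
      rw [← h5, Real.rpow_neg hγ.le]
      calc a ≤ _ := h3
        _ = _ := by ring
    exact le_of_mul_le_mul_right h6 (by positivity)
  have h7 := Real.rpow_le_rpow (by positivity) h4 hq0.le
  rw [← Real.rpow_mul ha, inv_mul_cancel₀ hq0.ne', Real.rpow_one,
    Real.mul_rpow hN (by positivity), ← Real.rpow_mul hγ.le] at h7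
  rw [mul_comm, div_eq_inv_mul, ← neg_mul]
  exact h7

theorem theorem4p6 {X : Type*} [NormedAddCommGroup X] [NormedSpace ℝ X] [CompleteSpace X]
    (p q : ℝ) (hp : 1 < p) (hq : 1 < q) (hpq : p⁻¹ + q⁻¹ = 1)
    (f : X → EReal) (hproper : IsProperFun f) (hlsc : LowerSemicontinuous f)
    (xbar : X) (hxbar : (0 : StrongDual ℝ X) ∈ fmSubdiff f xbar)
    (hstrict : ∀ x, x ≠ xbar → f xbar < f x)
    (hbdd : Bornology.IsBounded (closedConvexHull ℝ (effDom f)))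
    (hrnp : HasRNP (closedConvexHull ℝ (effDom f))) :
    (∃ γ : ℝ, 0 < γ ∧ ∀ x, f xbar + ((γ * ‖x - xbar‖ ^ p : ℝ) : EReal) ≤ f x) ↔
    (∃ μ : ℝ, 0 < μ ∧ ∀ x,
      f x - f xbar ≤ (μ : EReal) * ((Metric.infEDist 0 (fmSubdiff f x) ^ q : ℝ≥0∞) : EReal)) := by
  have hp0 : 0 < p := by linarith
  have hq0 : 0 < q := by linarith
  obtain ⟨hbot, x₀, hx₀⟩ := hproper
  have hmin : ∀ x, f xbar ≤ f x := by
    intro x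
    rcases eq_or_ne x xbar with rfl | hx
    · exact le_rfl
    · exact (hstrict x hx).le
  have hbdom : xbar ∈ effDom f := (hmin x₀).trans_lt hx₀
  obtain ⟨β, hβ⟩ : ∃ β : ℝ, f xbar = β :=
    ⟨_, (EReal.coe_toReal (ne_of_lt hbdom) (hbot xbar)).symm⟩
  -- Off the domain `toReal` gives the junk value 0, so F is meaningful only on `effDom f`.
  set F : X → ℝ := fun x => (f x).toReal - β with hFdef
  have hF : ∀ x ∈ effDom f, f x = ((F x + β : ℝ) : EReal) := by
    intro x hx
    rw [hFdef, sub_add_cancel, EReal.coe_toReal (ne_of_lt hx) (hbot x)]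
  have hFb : F xbar = 0 := by simp [hFdef, hβ]
  have hF0 : ∀ x ∈ effDom f, 0 ≤ F x := by
    intro x hx
    have := hmin x
    rw [hβ, hF x hx, EReal.coe_le_coe_iff] at this
    linarith
  have hnotdom : ∀ x, x ∉ effDom f → f x = ⊤ := fun x hx => not_lt_top_iff.1 hx
  have hsub : ∀ x ∈ effDom f, ∀ ξ : StrongDual ℝ X,
      ξ ∈ fmSubdiff f x ↔ ∀ y ∈ effDom f, F x - ξ x ≤ F y - ξ y := by
    intro x hx ξ
    constructor
    · intro hξ y hy
      have := hξ y
      rw [hF x hx, hF y hy, ← EReal.coe_sub, ← EReal.coe_sub, EReal.coe_le_coe_iff] at this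
      linarith
    · intro h y
      by_cases hy : y ∈ effDom f
      · have := h y hy
        rw [hF x hx, hF y hy, ← EReal.coe_sub, ← EReal.coe_sub, EReal.coe_le_coe_iff]
        linarith
      · rw [hnotdom y hy, EReal.top_sub_coe]
        exact le_top
  constructor
  · rintro ⟨γ, hγ, hgrow⟩
    refine ⟨γ ^ (-(q / p)), by positivity, fun x => ?_⟩
    have hc : 0 < γ ^ (-(q / p)) := by positivity
    rcases (fmSubdiff f x).eq_empty_or_nonempty with hemp | hne
    · rw [hemp, Metric.infEDist_empty, ENNReal.top_rpow_of_pos hq0, EReal.coe_ennreal_top,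
        EReal.coe_mul_top_of_pos hc]
      exact le_top
    have hx : x ∈ effDom f := by
      by_contra hx
      obtain ⟨ξ, hξ⟩ := hne
      have := hξ xbar
      rw [hnotdom x hx, EReal.top_sub_coe, hβ, ← EReal.coe_sub] at this
      exact absurd this (not_le.2 (EReal.coe_lt_top _))
    set N := (Metric.infEDist 0 (fmSubdiff f x)).toReal with hN
    have hNtop := Metric.infEDist_ne_top (x := (0 : StrongDual ℝ X)) hne
    have hcoe : ((Metric.infEDist 0 (fmSubdiff f x) ^ q : ℝ≥0∞) : EReal) = ((N ^ q : ℝ) : EReal) := by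
      rw [← ENNReal.ofReal_toReal hNtop, ← hN, ENNReal.ofReal_rpow_of_nonneg
        ENNReal.toReal_nonneg hq0.le, EReal.coe_ennreal_ofReal, max_eq_left (by positivity)]
    -- Subgradients of norm close to the infimum N suffice.
    have hle : F x ≤ N * ‖x - xbar‖ := by
      refine le_of_forall_pos_le_add fun ε hε => ?_
      have hlt : Metric.infDist 0 (fmSubdiff f x) < N + ε / (‖x - xbar‖ + 1) := by
        rw [hN, Metric.infDist]
        have : 0 < ε / (‖x - xbar‖ + 1) := by positivity
        linarith
      obtain ⟨ξ, hξ, hd⟩ := (Metric.infDist_lt_iff hne).1 hlt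
      rw [dist_zero_left] at hd
      have h1 := (hsub x hx ξ).1 hξ xbar hbdom
      have h2 := (le_abs_self _).trans (ξ.le_opNorm (x - xbar))
      rw [map_sub] at h2
      have h3 : ‖ξ‖ * ‖x - xbar‖ ≤ N * ‖x - xbar‖ + ε / (‖x - xbar‖ + 1) * ‖x - xbar‖ := by
        rw [← add_mul]
        gcongr
      have h4 : ε / (‖x - xbar‖ + 1) * ‖x - xbar‖ ≤ ε := by
        rw [div_mul_eq_mul_div, div_le_iff₀ (by positivity)]
        nlinarith [norm_nonneg (x - xbar)]
      linarith
    have hge : γ * ‖x - xbar‖ ^ p ≤ F x := by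
      have := hgrow x
      rw [hβ, hF x hx, ← EReal.coe_add, EReal.coe_le_coe_iff] at this
      linarith
    rw [hcoe, hβ, hF x hx, ← EReal.coe_sub, ← EReal.coe_mul, EReal.coe_le_coe_iff,
      add_sub_cancel_right]
    exact le_mul_rpow_of_growth hp hq hpq hγ (norm_nonneg _) ENNReal.toReal_nonneg hge hle
  · rintro ⟨μ, hμ, herr⟩
    obtain ⟨M, hM⟩ := hbdd.subset_closedBall xbar
    have htilt : IsTiltable (effDom f) F xbar M := ⟨⟨xbar, hbdom⟩, hF0, fun x hx => by
      have := hM (subset_closedConvexHull hx)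
      rwa [Metric.mem_closedBall, dist_eq_norm] at this⟩
    obtain ⟨γ, hγ, hgrow⟩ := htilt.growth_of_errorBound hp hq hpq hμ hbdom hFb
      (fun x hx hFx => by
        by_contra hne
        have := hstrict x hne
        rw [hβ, hF x hx, EReal.coe_lt_coe_iff] at this
        linarith)
      (fun a => by
        have : {x | x ∈ effDom f ∧ F x ≤ a} = f ⁻¹' Set.Iic ((a + β : ℝ) : EReal) := by
          ext x
          simp only [Set.mem_ofPred_eq, Set.mem_preimage, Set.mem_Iic]
          constructor
          · rintro ⟨hx, hxa⟩
            rw [hF x hx, EReal.coe_le_coe_iff]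
            linarith
          · intro hxa
            have hx : x ∈ effDom f := hxa.trans_lt (EReal.coe_lt_top _)
            rw [hF x hx, EReal.coe_le_coe_iff] at hxa
            exact ⟨hx, by linarith⟩
        rw [this]
        exact hlsc.isClosed_preimage _)
      (fun A hA hne => hrnp A hA hne (hbdd.subset hA))
      (fun x hx ξ hmax => by
        have hξ : ξ ∈ fmSubdiff f x := by
          rw [hsub x hx]
          intro y hy
          have h1 := htilt.le_tiltedSup ξ hy
          rw [hmax, map_sub, map_sub] at h1
          linarith
        have h1 : Metric.infEDist 0 (fmSubdiff f x) ^ q ≤ ENNReal.ofReal (‖ξ‖ ^ q) := by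
          rw [← ENNReal.ofReal_rpow_of_nonneg (norm_nonneg _) hq0.le]
          refine ENNReal.rpow_le_rpow ((Metric.infEDist_le_edist_of_mem hξ).trans_eq ?_) hq0.le
          rw [edist_dist, dist_zero_left]
        have h2 : ((Metric.infEDist 0 (fmSubdiff f x) ^ q : ℝ≥0∞) : EReal) ≤
            ((‖ξ‖ ^ q : ℝ) : EReal) := by
          refine (EReal.coe_ennreal_le_coe_ennreal_iff.2 h1).trans_eq ?_
          rw [EReal.coe_ennreal_ofReal, max_eq_left (by positivity)]
        have h3 := (herr x).trans
          (mul_le_mul_of_nonneg_left h2 (EReal.coe_nonneg.2 hμ.le))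
        rw [hβ, hF x hx, ← EReal.coe_sub, ← EReal.coe_mul, EReal.coe_le_coe_iff] at h3
        linarith)
    refine ⟨γ, hγ, fun x => ?_⟩
    by_cases hx : x ∈ effDom f
    · have := hgrow x hx
      rw [hβ, hF x hx, ← EReal.coe_add, EReal.coe_le_coe_iff]
      linarith
    · rw [hnotdom x hx]
      exact le_top
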